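/- Let $\mathbb{D}$ be (the original) Hechler forcing: conditions are pairs $\langle s,f\rangle$ with $s\in\omega^{<\omega}$ and $f\in\omega^\omega$, ordered by $\langle s',f'\rangle\leq\langle s,f\rangle$ if and only if $s\subseteq s'$, $f(n)\leq f'(n)$ for all $n$, and $f(n)\leq s'(n)$ for all $n$ with $|s|\leq n<|s'|$. Let $d\in\omega^\omega$ be a $\mathbb{D}$-generic real over $V$, that is, $d=\bigcup\{s:\langle s,f\rangle\in G\}$ for a $\mathbb{D}$-generic filter $G$ over $V$, so that $V[d]=V[G]$. For $x,y\in\omega^\omega$ write $x\leq^* y$ if $x(n)\leq y(n)$ for all but finitely many $n$ ("$x$ is eventually dominated by $y$"). A real $x\in\omega^\omega\cap V[d]$ is called unbounded if $x\not\leq^* f$ for every $f\in\omega^\omega\cap V$, and a real $y\in\omega^\omega\cap V[d]$ is called dominating if $f\leq^* y$ for every $f\in\omega^\omega\cap V$. Then there is an unbounded real $x\in\omega^\omega\cap V[d]$ such that $x\leq^* y$ for every dominating real $y\in\omega^\omega\cap V[d]$. -/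

import Mathlib

universe u

/-! The ground model `V` is the universe of sets of level `u`, its reals are the functions `ℕ → ℕ`.
The generic extension of `V` by a notion of forcing `P` is described in the usual way: its objects
are given by `P`-names, and a sentence about it holds in all generic extensions if and only if it
is forced by all conditions. -/

namespace Forcing

/-- `P`-names: a name is a (small) family of pairs consisting of a name and a condition. -/
inductive PName (P : Type) : Type (u + 1)
  | mk (ι : Type u) (elt : ι → PName P) (cond : ι → P) : PName P

/-- Sentences of the forcing language, identified with the set of conditions forcing them. They are
only formed with the clauses of the forcing relation below. -/
abbrev Sentence (P : Type) : Type := P → Prop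

section Relation

variable {P : Type} [Preorder P]

/-- `p ⊩ φ`. Stronger conditions are smaller. -/
def Forces (p : P) (φ : Sentence P) : Prop := φ p

/-- `p ⊩ ¬ φ` iff no `q ≤ p` forces `φ`. -/
def neg (φ : Sentence P) : Sentence P := fun p => ∀ q ≤ p, ¬ Forces q φ

/-- `p ⊩ φ ∧ ψ` iff `p ⊩ φ` and `p ⊩ ψ`. -/
def conj (φ ψ : Sentence P) : Sentence P := fun p => Forces p φ ∧ Forces p ψ

/-- `p ⊩ ∀ x, φ x` iff `p ⊩ φ x` for all `x`. It is used with `x` ranging over all names (a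
quantifier over the extension) and with `x` ranging over the reals of the ground model. -/
def all {ι : Type*} (φ : ι → Sentence P) : Sentence P := fun p => ∀ x, Forces p (φ x)

/-- Disjunction, as a classical abbreviation. -/
def disj (φ ψ : Sentence P) : Sentence P := neg (conj (neg φ) (neg ψ))

/-- Implication, as a classical abbreviation. -/
def imp (φ ψ : Sentence P) : Sentence P := neg (conj φ (neg ψ))

/-- Existential quantification, as a classical abbreviation. -/
def ex {ι : Type*} (φ : ι → Sentence P) : Sentence P := neg (all fun x => neg (φ x))

/-- `p ⊩ σ = τ`: whenever `q ≤ p` puts an element of one of the two names into its set, some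
`r ≤ q` puts into the other one an element that `r` forces to be equal to it. -/
def eq : PName.{u} P → PName.{u} P → Sentence P
  | ⟨_, a, c⟩, ⟨_, b, d⟩ => fun p =>
      (∀ i, ∀ q ≤ p, q ≤ c i → ∃ r ≤ q, ∃ j, r ≤ d j ∧ eq (a i) (b j) r) ∧
      (∀ j, ∀ q ≤ p, q ≤ d j → ∃ r ≤ q, ∃ i, r ≤ c i ∧ eq (a i) (b j) r)

/-- `p ⊩ σ ∈ τ`: the conditions that put into `τ` an element that they force to be equal to `σ` are
dense below `p`. -/
def mem (σ : PName.{u} P) : PName.{u} P → Sentence P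
  | ⟨_, b, d⟩ => fun p => ∀ q ≤ p, ∃ r ≤ q, ∃ j, r ≤ d j ∧ Forces r (eq σ (b j))

/-- The bounded quantifier `∀ x ∈ τ, φ x`. -/
def allIn (τ : PName.{u} P) (φ : PName.{u} P → Sentence P) : Sentence P :=
  all fun x : PName.{u} P => imp (mem x τ) (φ x)

/-- The bounded quantifier `∃ x ∈ τ, φ x`. -/
def exIn (τ : PName.{u} P) (φ : PName.{u} P → Sentence P) : Sentence P :=
  ex fun x : PName.{u} P => conj (mem x τ) (φ x)

end Relation

section Names

variable {P : Type} [Preorder P] [OrderTop P]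

/-- The canonical name of a set of the ground model. -/
def check : PSet.{u} → PName.{u} P
  | ⟨ι, a⟩ => ⟨ι, fun i => check (a i), fun _ => ⊤⟩

/-- The name of the set of natural numbers. -/
def omega : PName.{u} P := check PSet.omega

/-- The name of a natural number (a von Neumann ordinal). -/
def natName (n : ℕ) : PName.{u} P := check (PSet.ofNat n)

/-- The name of the unordered pair. -/
def upair (σ τ : PName.{u} P) : PName.{u} P :=
  ⟨ULift Bool, fun i => cond i.down σ τ, fun _ => ⊤⟩

/-- The name of the (Kuratowski) ordered pair. -/
def opair (σ τ : PName.{u} P) : PName.{u} P := upair (upair σ σ) (upair σ τ)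

/-- The canonical name of a real of the ground model, as a set of ordered pairs. -/
def groundReal (f : ℕ → ℕ) : PName.{u} P :=
  ⟨ULift ℕ, fun n => opair (natName n.down) (natName (f n.down)), fun _ => ⊤⟩

/-- `m ≤ n`, for natural numbers `m`, `n` of the extension. -/
def natLE (m n : PName.{u} P) : Sentence P := disj (mem m n) (eq m n)

/-- `x ∈ ω^ω`: the set `x` is a function from `ω` to `ω`. -/
def isReal (x : PName.{u} P) : Sentence P :=
  conj (allIn x fun z => exIn omega fun n => exIn omega fun m => eq z (opair n m))
    (conj (allIn omega fun n => exIn omega fun m => mem (opair n m) x)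
      (allIn omega fun n => allIn omega fun m => allIn omega fun m' =>
        imp (conj (mem (opair n m) x) (mem (opair n m') x)) (eq m m')))

/-- `x ≤* y`, for reals `x`, `y` of the extension: `x n ≤ y n` for all but finitely many `n`. -/
def eventuallyLE (x y : PName.{u} P) : Sentence P :=
  exIn omega fun k => allIn omega fun n => imp (natLE k n)
    (allIn omega fun a => allIn omega fun b =>
      imp (conj (mem (opair n a) x) (mem (opair n b) y)) (natLE a b))

/-- `x` is an unbounded real over the ground model. -/
def isUnbounded (x : PName.{u} P) : Sentence P :=
  conj (isReal x) (all fun f : ℕ → ℕ => neg (eventuallyLE x (groundReal f)))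

/-- `y` is a dominating real over the ground model. -/
def isDominating (y : PName.{u} P) : Sentence P :=
  conj (isReal y) (all fun f : ℕ → ℕ => eventuallyLE (groundReal f) y)

end Names

end Forcing

/-- Conditions of the original Hechler forcing: a finite sequence and a real. -/
structure HechlerCond : Type where
  stem : List ℕ
  commitment : ℕ → ℕ

namespace HechlerCond

/-- `q ≤ p` iff the stem of `q` extends that of `p`, the commitment of `q` is everywhere at least
that of `p`, and the new values of the stem of `q` respect the commitment of `p`. -/
instance : Preorder HechlerCond where
  le q p := p.stem <+: q.stem ∧ (∀ n, p.commitment n ≤ q.commitment n) ∧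
    ∀ n, p.stem.length ≤ n → ∀ h : n < q.stem.length, p.commitment n ≤ q.stem[n]
  le_refl p := ⟨List.prefix_refl _, fun _ => le_rfl, fun n h h' => absurd h' (by omega)⟩
  le_trans r q p hrq hqp := by
    obtain ⟨h1, h2, h3⟩ := hrq
    obtain ⟨k1, k2, k3⟩ := hqp
    refine ⟨k1.trans h1, fun n => (k2 n).trans (h2 n), fun n hn h => ?_⟩
    by_cases hq : n < q.stem.length
    · have e : q.stem[n] = r.stem[n] := h1.getElem hq
      exact e ▸ k3 n hn hq
    · exact (k2 n).trans (h3 n (by omega) h)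

/-- The weakest condition has the empty stem and the zero commitment. -/
instance : OrderTop HechlerCond where
  top := ⟨[], fun _ => 0⟩
  le_top _ := ⟨List.nil_prefix, fun _ => Nat.zero_le _, fun _ _ _ => Nat.zero_le _⟩

end HechlerCond

/-!
Let `d` be the Hechler real and let `u₀, u₁, …` enumerate the finite sequences of natural numbers.
The witness `x` reads off lengths of constant runs of `d`: if `uₙ` is an initial segment of `d`,
then `x n` is the end of the run on which `d` is constant right after `uₙ`, and otherwise `x n = 0`.

It is unbounded (`isUnbounded_runReal`), because any condition can first be extended so that its
stem gets a large code `n`, and then by a constant run that is longer than a given `h n`.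

It lies below each dominating real `y` (`eventuallyLE_runReal`). Say that a stem `s` allows
`y n ≤ m` if no commitment `f` makes `⟨s, f⟩` force `y n > m`. Let `g` be a ground model real such
that `g n` exceeds some `m` with `uₙ` allowing `y n ≤ m`, if there is such an `m`. Some condition
`⟨s, f₀⟩` forces `g n ≤ y n` for all `n ≥ k`. So if `n ≥ k` and `uₙ` extends `s` in accordance with
`f₀`, then `uₙ` allows no bound at all: for each `m` there is a commitment `F n m` such that
`⟨uₙ, F n m⟩` forces `y n > m`. Let `f ≥ f₀` be such that `f j` bounds all `F n m i` with `n, i ≤ j`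
and `m ≤ j + 1`. Suppose that an extension of `⟨s, f⟩` decides `x n = a`. Its stem is constant after
`uₙ` up to `a - 1`, so all these values are at least `f (a - 1)`, and hence they obey `F n a`
although `f` itself may be small at the start of the run. So the condition is compatible with
`⟨uₙ, F n a⟩`, which forces `a < y n`.

All this takes place in the forcing language. Bounded quantifiers over `ω` are reduced to standard
natural numbers, and `≤*` to the relation `Val x n m`, that is, `x n = m` (`eventuallyLE_iff`).
-/

namespace Forcing

/-! ### The logical connectives and the axioms of equality -/

section Relation

variable {P : Type} [Preorder P]

theorem ex_iff {ι : Type*} {φ : ι → Sentence P} {p : P} :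
    ex φ p ↔ ∀ q ≤ p, ∃ r ≤ q, ∃ x, φ x r := by
  simp only [ex, neg, all, Forces]
  push Not
  exact ⟨fun h q hq => let ⟨x, r, hr, h⟩ := h q hq; ⟨r, hr, x, h⟩,
    fun h q hq => let ⟨r, hr, x, h⟩ := h q hq; ⟨x, r, hr, h⟩⟩

theorem imp_iff {φ ψ : Sentence P} {p : P} :
    imp φ ψ p ↔ ∀ q ≤ p, φ q → ∃ r ≤ q, ψ r := by
  simp only [imp, neg, conj, Forces]
  push Not
  rfl

theorem disj_iff {φ ψ : Sentence P} {p : P} :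
    disj φ ψ p ↔ ∀ q ≤ p, ∃ r ≤ q, φ r ∨ ψ r := by
  simp only [disj, neg, conj, Forces]
  refine forall₂_congr fun q _ => ⟨fun h => ?_, ?_⟩
  · by_contra! hc
    exact h ⟨fun r hr hφ => (hc r hr).1 hφ, fun r hr hψ => (hc r hr).2 hψ⟩
  · rintro ⟨r, hr, h | h⟩ ⟨h1, h2⟩
    exacts [h1 r hr h, h2 r hr h]

theorem exIn_iff {τ : PName.{u} P} {φ : PName.{u} P → Sentence P} {p : P} :
    exIn τ φ p ↔ ∀ q ≤ p, ∃ r ≤ q, ∃ x, mem x τ r ∧ φ x r :=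
  ex_iff

theorem allIn_iff {τ : PName.{u} P} {φ : PName.{u} P → Sentence P} {p : P} :
    allIn τ φ p ↔ ∀ x, ∀ q ≤ p, mem x τ q → ∃ r ≤ q, φ x r :=
  forall_congr' fun _ => imp_iff

theorem eq_mono {σ τ : PName.{u} P} {p q : P} (hq : q ≤ p) (h : eq σ τ p) : eq σ τ q := by
  cases σ; cases τ
  rw [eq] at h ⊢
  exact ⟨fun i r hr => h.1 i r (hr.trans hq), fun j r hr => h.2 j r (hr.trans hq)⟩

theorem mem_mono {σ τ : PName.{u} P} {p q : P} (hq : q ≤ p) (h : mem σ τ p) : mem σ τ q := by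
  cases τ
  exact fun r hr => h r (hr.trans hq)

theorem eq_refl (σ : PName.{u} P) (p : P) : eq σ σ p := by
  induction σ generalizing p with
  | mk ι a c ih =>
    rw [eq]
    exact ⟨fun i q _ hi => ⟨q, le_rfl, i, hi, ih i q⟩, fun i q _ hi => ⟨q, le_rfl, i, hi, ih i q⟩⟩

theorem eq_symm {σ τ : PName.{u} P} {p : P} (h : eq σ τ p) : eq τ σ p := by
  induction σ generalizing τ p with
  | mk ι a c ih =>
    cases τ
    rw [eq] at h ⊢
    refine ⟨fun j q hq hj => ?_, fun i q hq hi => ?_⟩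
    · obtain ⟨r, hr, i, hi, h⟩ := h.2 j q hq hj
      exact ⟨r, hr, i, hi, ih i h⟩
    · obtain ⟨r, hr, j, hj, h⟩ := h.1 i q hq hi
      exact ⟨r, hr, j, hj, ih i h⟩

theorem eq_trans {σ τ ρ : PName.{u} P} {p : P} (h : eq σ τ p) (h' : eq τ ρ p) : eq σ ρ p := by
  induction σ generalizing τ ρ p with
  | mk ι a c ih =>
    cases τ; cases ρ
    rw [eq] at h h' ⊢
    refine ⟨fun i q hq hi => ?_, fun k q hq hk => ?_⟩
    · obtain ⟨r, hr, j, hj, e⟩ := h.1 i q hq hi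
      obtain ⟨s, hs, k, hk, e'⟩ := h'.1 j r (hr.trans hq) hj
      exact ⟨s, hs.trans hr, k, hk, ih i (eq_mono hs e) e'⟩
    · obtain ⟨r, hr, j, hj, e'⟩ := h'.2 k q hq hk
      obtain ⟨s, hs, i, hi, e⟩ := h.2 j r (hr.trans hq) hj
      exact ⟨s, hs.trans hr, i, hi, ih i e (eq_mono hs e')⟩

theorem mem_congr {σ σ' τ τ' : PName.{u} P} {p : P} (hσ : eq σ σ' p) (hτ : eq τ τ' p)
    (h : mem σ τ p) : mem σ' τ' p := by
  cases τ; cases τ'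
  intro q hq
  rw [eq] at hτ
  obtain ⟨r, hr, j, hj, e⟩ := h q hq
  obtain ⟨s, hs, k, hk, e'⟩ := hτ.1 j r (hr.trans hq) hj
  exact ⟨s, hs.trans hr, k, hk,
    eq_trans (eq_symm (eq_mono (hs.trans (hr.trans hq)) hσ)) (eq_trans (eq_mono hs e) e')⟩

theorem natLE_congr {σ σ' τ τ' : PName.{u} P} {p : P} (hσ : eq σ σ' p) (hτ : eq τ τ' p)
    (h : natLE σ τ p) : natLE σ' τ' p := by
  simp only [natLE, disj_iff] at h ⊢
  intro q hq
  obtain ⟨r, hr, h⟩ := h q hq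
  have e := eq_mono (hr.trans hq) hσ
  have e' := eq_mono (hr.trans hq) hτ
  exact ⟨r, hr, h.imp (mem_congr e e') fun h => eq_trans (eq_symm e) (eq_trans h e')⟩

end Relation

/-! ### Absoluteness of natural numbers and pairs -/

section Names

variable {P : Type} [Preorder P] [OrderTop P]

/-- Equality of ground model sets is absolute. -/
theorem eq_check_iff {a b : PSet.{u}} {p : P} : eq (check a) (check b) p ↔ PSet.Equiv a b := by
  induction a generalizing b p with
  | mk ι a ih =>
    obtain ⟨κ, b⟩ := b
    simp only [check, eq, ih, PSet.Equiv, le_top, true_and, true_imp_iff]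
    refine and_congr (forall_congr' fun i => ?_) (forall_congr' fun j => ?_)
    · exact ⟨fun h => let ⟨_, _, h⟩ := h p le_rfl; h, fun h q _ => ⟨q, le_rfl, h⟩⟩
    · exact ⟨fun h => let ⟨_, _, h⟩ := h p le_rfl; h, fun h q _ => ⟨q, le_rfl, h⟩⟩

/-- Membership between ground model sets is absolute. -/
theorem mem_check_iff {a b : PSet.{u}} {p : P} : mem (check a) (check b) p ↔ a ∈ b := by
  obtain ⟨κ, b⟩ := b
  simp only [check, mem, Forces, eq_check_iff, le_top, true_and, PSet.mem_def]
  exact ⟨fun h => let ⟨_, _, h⟩ := h p le_rfl; h, fun h q _ => ⟨q, le_rfl, h⟩⟩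

theorem rank_ofNat (n : ℕ) : (PSet.ofNat.{u} n).rank = n := by
  induction n with
  | zero => exact PSet.rank_empty
  | succ n ih =>
    rw [PSet.ofNat, PSet.rank_insert, ih, Nat.cast_succ, ← Order.succ_eq_add_one]
    exact max_eq_left (Order.le_succ _)

theorem equiv_ofNat_iff {m n : ℕ} : PSet.Equiv (PSet.ofNat.{u} m) (PSet.ofNat.{u} n) ↔ m = n := by
  refine ⟨fun h => ?_, fun h => h ▸ PSet.Equiv.rfl⟩
  have := PSet.rank_congr h
  rwa [rank_ofNat, rank_ofNat, Nat.cast_inj] at this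

theorem ofNat_mem_ofNat_iff {m n : ℕ} : PSet.ofNat.{u} m ∈ PSet.ofNat.{u} n ↔ m < n := by
  induction n with
  | zero => exact iff_of_false (PSet.notMem_empty _) (Nat.not_lt_zero m)
  | succ n ih => rw [PSet.ofNat, PSet.mem_insert_iff, ih, equiv_ofNat_iff, Nat.lt_succ_iff_lt_or_eq,
      or_comm]

theorem eq_natName_iff {m n : ℕ} {p : P} : eq (natName.{u} m) (natName n) p ↔ m = n :=
  eq_check_iff.trans equiv_ofNat_iff

theorem natLE_natName_iff {m n : ℕ} {p : P} :
    natLE (natName.{u} m) (natName n) p ↔ m ≤ n := by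
  have (r : P) : mem (natName.{u} m) (natName n) r ∨ eq (natName.{u} m) (natName n) r ↔ m ≤ n := by
    rw [eq_natName_iff, natName, natName, mem_check_iff, ofNat_mem_ofNat_iff, le_iff_lt_or_eq]
  simp only [natLE, disj_iff, this]
  exact ⟨fun h => let ⟨_, _, h⟩ := h p le_rfl; h, fun h q _ => ⟨q, le_rfl, h⟩⟩

theorem natName_mem_omega (n : ℕ) (p : P) : mem (natName.{u} n) omega p :=
  mem_check_iff.2 (PSet.mem_def.2 ⟨⟨n⟩, PSet.Equiv.rfl⟩)

theorem exists_eq_natName {σ : PName.{u} P} {p : P} (h : mem σ omega p) :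
    ∃ q ≤ p, ∃ n, eq σ (natName n) q := by
  obtain ⟨q, hq, n, -, h⟩ := h p le_rfl
  exact ⟨q, hq, n.down, h⟩

/-- A pre-set with the two members `a` and `b`, indexed by the Booleans as in `upair`. -/
def boolPair (a b : PSet.{u}) : PSet.{u} :=
  ⟨ULift Bool, fun i => cond i.down a b⟩

theorem upair_check (a b : PSet.{u}) :
    upair (check a : PName.{u} P) (check b) = check (boolPair a b) := by
  simp only [upair, boolPair, check, PName.mk.injEq, heq_eq_eq, true_and, and_true]
  ext ⟨_ | _⟩ <;> rfl

theorem mk_boolPair (a b : PSet.{u}) :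
    ZFSet.mk (boolPair a b) = {ZFSet.mk a, ZFSet.mk b} := by
  ext z
  induction z using Quotient.inductionOn with
  | h z =>
    rw [ZFSet.mk_eq, ZFSet.mk_mem_iff, ZFSet.mem_pair, PSet.mem_def, ZFSet.eq, ZFSet.eq]
    simp only [boolPair, ULift.exists, PSet.Type, PSet.Func, Bool.exists_bool, cond_true,
      cond_false]
    exact or_comm

theorem eq_opair_natName_iff {n m n' m' : ℕ} {p : P} :
    eq (opair (natName.{u} n) (natName m)) (opair (natName n') (natName m')) p ↔
      n = n' ∧ m = m' := by
  have key (n m : ℕ) : ZFSet.mk (boolPair (boolPair (PSet.ofNat.{u} n) (PSet.ofNat n))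
      (boolPair (PSet.ofNat n) (PSet.ofNat m))) =
      ZFSet.pair (ZFSet.mk (PSet.ofNat n)) (ZFSet.mk (PSet.ofNat m)) := by
    simp only [mk_boolPair, ZFSet.pair, ZFSet.pair_eq_singleton]
  simp only [opair, natName, upair_check]
  rw [eq_check_iff, ← ZFSet.eq, key, key, ZFSet.pair_inj, ZFSet.eq, ZFSet.eq, equiv_ofNat_iff,
    equiv_ofNat_iff]

theorem upair_congr {σ σ' τ τ' : PName.{u} P} {p : P} (hσ : eq σ σ' p) (hτ : eq τ τ' p) :
    eq (upair σ τ) (upair σ' τ') p := by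
  have (i : ULift.{u} Bool) : eq (cond i.down σ τ) (cond i.down σ' τ') p := by
    obtain ⟨_ | _⟩ := i <;> assumption
  rw [upair, upair, eq]
  exact ⟨fun i q hq hi => ⟨q, le_rfl, i, hi, eq_mono hq (this i)⟩,
    fun i q hq hi => ⟨q, le_rfl, i, hi, eq_mono hq (this i)⟩⟩

theorem opair_congr {σ σ' τ τ' : PName.{u} P} {p : P} (hσ : eq σ σ' p) (hτ : eq τ τ' p) :
    eq (opair σ τ) (opair σ' τ') p :=
  upair_congr (upair_congr hσ hσ) (upair_congr hσ hτ)

/-! ### Values of reals -/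

/-- `p ⊩ x n = m`, for standard natural numbers `n` and `m`. -/
def Val (x : PName.{u} P) (n m : ℕ) : Sentence P := mem (opair (natName n) (natName m)) x

theorem Val.mono {x : PName.{u} P} {n m : ℕ} {p q : P} (h : Val x n m p) (hq : q ≤ p) :
    Val x n m q :=
  mem_mono hq h

theorem val_groundReal (f : ℕ → ℕ) (n : ℕ) (p : P) : Val (groundReal.{u} f) n (f n) p :=
  fun q _ => ⟨q, le_rfl, ⟨n⟩, le_top, eq_refl _ _⟩

/-- Eventual domination, in terms of the values at standard natural numbers. -/
theorem eventuallyLE_iff {x y : PName.{u} P} {p : P} :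
    eventuallyLE x y p ↔ ∀ q ≤ p, ∃ r ≤ q, ∃ k, ∀ n ≥ k, ∀ s ≤ r, ∀ a b,
      Val x n a s → Val y n b s → a ≤ b := by
  simp only [eventuallyLE, exIn_iff, allIn_iff, imp_iff, conj, Forces]
  refine forall₂_congr fun q _ => ⟨?_, ?_⟩
  · rintro ⟨r, hr, κ, hκ, h⟩
    obtain ⟨r', hr', k, e⟩ := exists_eq_natName hκ
    refine ⟨r', hr'.trans hr, k, fun n hn s hs a b ha hb => ?_⟩
    obtain ⟨s₁, h₁, h⟩ := h _ s (hs.trans hr') (natName_mem_omega n s)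
    obtain ⟨s₂, h₂, h⟩ := h s₁ le_rfl
      (natLE_congr (eq_symm (eq_mono (h₁.trans hs) e)) (eq_refl _ _) (natLE_natName_iff.2 hn))
    obtain ⟨s₃, h₃, h⟩ := h _ s₂ le_rfl (natName_mem_omega a s₂)
    obtain ⟨s₄, h₄, h⟩ := h _ s₃ le_rfl (natName_mem_omega b s₃)
    have h₀ : s₄ ≤ s := h₄.trans (h₃.trans (h₂.trans h₁))
    obtain ⟨s₅, -, h⟩ := h s₄ le_rfl ⟨ha.mono h₀, hb.mono h₀⟩
    exact natLE_natName_iff.1 h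
  · rintro ⟨r, hr, k, h⟩
    refine ⟨r, hr, natName k, natName_mem_omega k r, fun ν s₁ h₁ hν => ⟨s₁, le_rfl, ?_⟩⟩
    refine fun s₂ h₂ hkν => ⟨s₂, le_rfl, fun α s₃ h₃ hα => ⟨s₃, le_rfl, ?_⟩⟩
    refine fun β s₄ h₄ hβ => ⟨s₄, le_rfl, ?_⟩
    rintro s₅ h₅ ⟨hx, hy⟩
    obtain ⟨t₁, i₁, n, en⟩ := exists_eq_natName
      (mem_mono (h₅.trans (h₄.trans (h₃.trans h₂))) hν)
    obtain ⟨t₂, i₂, a, ea⟩ := exists_eq_natName (mem_mono (i₁.trans (h₅.trans h₄)) hα)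
    obtain ⟨t₃, i₃, b, eb⟩ := exists_eq_natName (mem_mono (i₂.trans (i₁.trans h₅)) hβ)
    have j : t₃ ≤ s₅ := i₃.trans (i₂.trans i₁)
    replace en := eq_mono (i₃.trans i₂) en
    replace ea := eq_mono i₃ ea
    have hkn : k ≤ n := natLE_natName_iff.1 (natLE_congr (eq_refl _ _) en
      (disj_iff.2 fun q hq => disj_iff.1 hkν q (hq.trans (j.trans (h₅.trans (h₄.trans h₃))))))
    have hab : a ≤ b := h n hkn t₃
      (j.trans (h₅.trans (h₄.trans (h₃.trans (h₂.trans h₁))))) a b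
      (mem_congr (opair_congr en ea) (eq_refl _ _) (mem_mono j hx))
      (mem_congr (opair_congr en eb) (eq_refl _ _) (mem_mono j hy))
    exact ⟨t₃, j, natLE_congr (eq_symm ea) (eq_symm eb) (natLE_natName_iff.2 hab)⟩

/-- The name of the set of all pairs `(n, m)` such that `R p n m` for some `p` in the generic
filter. -/
def relName (R : P → ℕ → ℕ → Prop) : PName.{u} P :=
  ⟨ULift {c : P × ℕ × ℕ // R c.1 c.2.1 c.2.2},
    fun i => opair (natName i.down.1.2.1) (natName i.down.1.2.2), fun i => i.down.1.1⟩

theorem val_relName {R : P → ℕ → ℕ → Prop} {n m : ℕ} {p : P} (h : R p n m) :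
    Val (relName.{u} R) n m p :=
  fun q hq => ⟨q, le_rfl, ⟨⟨(p, n, m), h⟩⟩, hq, eq_refl _ _⟩

theorem exists_eq_of_mem_relName {R : P → ℕ → ℕ → Prop} {σ : PName.{u} P} {p : P}
    (hR : ∀ p q n m, q ≤ p → R p n m → R q n m) (h : mem σ (relName R) p) :
    ∃ q ≤ p, ∃ n m, R q n m ∧ eq σ (opair (natName n) (natName m)) q := by
  obtain ⟨q, hq, ⟨⟨⟨r, n, m⟩, h⟩⟩, hj, e⟩ := h p le_rfl
  exact ⟨q, hq, n, m, hR _ _ _ _ hj h, e⟩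

theorem exists_of_val_relName {R : P → ℕ → ℕ → Prop} {n m : ℕ} {p : P}
    (hR : ∀ p q n m, q ≤ p → R p n m → R q n m) (h : Val (relName.{u} R) n m p) :
    ∃ q ≤ p, R q n m := by
  obtain ⟨q, hq, n', m', h, e⟩ := exists_eq_of_mem_relName hR h
  obtain ⟨rfl, rfl⟩ := eq_opair_natName_iff.1 e
  exact ⟨q, hq, h⟩

/-- `relName R` is a real if `R` is persistent, single-valued and densely total. -/
theorem isReal_relName {R : P → ℕ → ℕ → Prop} (hR : ∀ p q n m, q ≤ p → R p n m → R q n m)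
    (hfun : ∀ p n m m', R p n m → R p n m' → m = m') (htot : ∀ p n, ∃ q ≤ p, ∃ m, R q n m)
    (p : P) : isReal (relName.{u} R) p := by
  simp only [isReal, exIn_iff, allIn_iff, imp_iff, conj, Forces]
  refine ⟨fun σ q _ h => ⟨q, le_rfl, fun r hr => ?_⟩, fun ν q _ h => ⟨q, le_rfl, fun r hr => ?_⟩,
    fun ν q _ hν => ⟨q, le_rfl, fun μ r hr hμ => ⟨r, le_rfl, fun μ' s hs hμ' =>
      ⟨s, le_rfl, fun t ht h => ?_⟩⟩⟩⟩
  · obtain ⟨s, hs, n, m, -, e⟩ := exists_eq_of_mem_relName hR (mem_mono hr h)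
    exact ⟨s, hs, natName n, natName_mem_omega n s, fun t ht => ⟨t, le_rfl, natName m,
      natName_mem_omega m t, eq_mono ht e⟩⟩
  · obtain ⟨s, hs, n, e⟩ := exists_eq_natName (mem_mono hr h)
    obtain ⟨t, ht, m, hm⟩ := htot s n
    exact ⟨t, ht.trans hs, natName m, natName_mem_omega m t,
      mem_congr (opair_congr (eq_symm (eq_mono ht e)) (eq_refl _ _)) (eq_refl _ _)
        (val_relName hm)⟩
  · obtain ⟨t₁, i₁, n, en⟩ := exists_eq_natName (mem_mono (ht.trans (hs.trans hr)) hν)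
    obtain ⟨t₂, i₂, m, em⟩ := exists_eq_natName (mem_mono (i₁.trans (ht.trans hs)) hμ)
    obtain ⟨t₃, i₃, m', em'⟩ := exists_eq_natName (mem_mono (i₂.trans (i₁.trans ht)) hμ')
    have j : t₃ ≤ t := i₃.trans (i₂.trans i₁)
    replace en := eq_mono (i₃.trans i₂) en
    replace em := eq_mono i₃ em
    obtain ⟨t₄, i₄, h₄⟩ := exists_of_val_relName hR (n := n) (m := m)
      (mem_congr (opair_congr en em) (eq_refl _ _) (mem_mono j h.1))
    obtain ⟨t₅, i₅, h₅⟩ := exists_of_val_relName hR (n := n) (m := m')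
      (mem_congr (opair_congr (eq_mono i₄ en) (eq_mono i₄ em')) (eq_refl _ _)
        (mem_mono (i₄.trans j) h.2))
    obtain rfl := hfun t₅ n m m' (hR _ _ _ _ i₅ h₄) h₅
    exact ⟨t₃, j, eq_trans em (eq_symm em')⟩

end Names

end Forcing

/-! ### Constant runs of the Hechler real -/

namespace HechlerCond

theorem le_iff {q p : HechlerCond} : q ≤ p ↔ p.stem <+: q.stem ∧
    (∀ n, p.commitment n ≤ q.commitment n) ∧
    ∀ n, p.stem.length ≤ n → n < q.stem.length → p.commitment n ≤ q.stem.getD n 0 := by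
  refine and_congr_right fun _ => and_congr_right fun _ => forall₂_congr fun n _ =>
    forall_congr' fun h => ?_
  rw [List.getD_eq_getElem _ _ h]

theorem getD_of_prefix {s t : List ℕ} (h : s <+: t) {i : ℕ} (hi : i < s.length) :
    t.getD i 0 = s.getD i 0 := by
  obtain ⟨w, rfl⟩ := h
  exact List.getD_append _ _ _ _ hi

/-- `t` decides that the value coded by `u` is `m`: either `u` is ruled out as an initial segment
of the generic real, and `m = 0`, or `u` is an initial segment of `t`, and `m` is the end of the
longest constant run of `t` starting right after `u`, the next value of `t` being different. -/
def RunEnd (u t : List ℕ) (m : ℕ) : Prop :=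
  (u.length ≤ t.length ∧ ¬ u <+: t ∧ m = 0) ∨
    (u <+: t ∧ u.length < m ∧ m < t.length ∧
      (∀ i, u.length ≤ i → i < m → t.getD i 0 = t.getD u.length 0) ∧
      t.getD m 0 ≠ t.getD u.length 0)

theorem RunEnd.mono {u t t' : List ℕ} {m : ℕ} (h : RunEnd u t m) (ht : t <+: t') :
    RunEnd u t' m := by
  obtain ⟨h1, h2, h3⟩ | ⟨h1, h2, h3, h4, h5⟩ := h
  · exact .inl ⟨h1.trans ht.length_le, fun hu => h2 (List.prefix_of_prefix_length_le hu ht h1), h3⟩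
  · have e := getD_of_prefix ht (h2.trans h3)
    refine .inr ⟨h1.trans ht, h2, h3.trans_le ht.length_le, fun i hi him => ?_, ?_⟩
    · rw [getD_of_prefix ht (him.trans h3), e, h4 i hi him]
    · rwa [getD_of_prefix ht h3, e]

theorem RunEnd.unique {u t : List ℕ} {m m' : ℕ} (h : RunEnd u t m) (h' : RunEnd u t m') :
    m = m' := by
  obtain ⟨h1, h2, h3⟩ | ⟨h1, h2, h3, h4, h5⟩ := h <;>
    obtain ⟨k1, k2, k3⟩ | ⟨k1, k2, k3, k4, k5⟩ := h'
  · rw [h3, k3]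
  · exact absurd k1 h2
  · exact absurd h1 k2
  · obtain h | h | h := lt_trichotomy m m'
    · exact absurd (k4 m h2.le h) h5
    · exact h
    · exact absurd (h4 m' k2.le h) k5

/-- Lengthening the stem by a constant run and one larger value, all of them obeying the
commitment. -/
theorem exists_le_runEnd (p : HechlerCond) {m : ℕ} (hm : p.stem.length < m) :
    ∃ q ≤ p, RunEnd p.stem q.stem m := by
  obtain ⟨s, f⟩ := p
  obtain ⟨c, hc⟩ := ((Set.finite_Iic m).image f).bddAbove
  replace hc (i : ℕ) (hi : i ≤ m) : f i ≤ c := hc ⟨i, hi, rfl⟩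
  replace hm : s.length < m := hm
  have hl : (s ++ List.replicate (m - s.length) c).length = m := by simp; lia
  have e (i : ℕ) (hi : s.length ≤ i) (him : i < m) :
      (s ++ List.replicate (m - s.length) c ++ [c + 1]).getD i 0 = c := by
    rw [List.getD_append _ _ _ _ (by lia), List.getD_append_right _ _ _ _ hi,
      List.getD_replicate _ (by lia)]
  have e' : (s ++ List.replicate (m - s.length) c ++ [c + 1]).getD m 0 = c + 1 := by
    rw [List.getD_append_right _ _ _ _ hl.le, hl]
    simp
  have hp : s <+: s ++ List.replicate (m - s.length) c ++ [c + 1] :=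
    (List.prefix_append _ _).trans (List.prefix_append _ _)
  refine ⟨⟨s ++ List.replicate (m - s.length) c ++ [c + 1], f⟩,
    le_iff.2 ⟨hp, fun _ => le_rfl, fun i hi hi' => ?_⟩,
    .inr ⟨hp, hm, by rw [List.length_append, hl]; simp, fun i hi him => ?_, ?_⟩⟩
  · rw [List.length_append, hl] at hi'
    obtain h | rfl : i < m ∨ i = m := by simp at hi'; lia
    · exact (hc i h.le).trans (e i hi h).ge
    · exact (hc i le_rfl).trans (by simp only [e']; lia)
  · rw [e i hi him, e _ le_rfl hm]
  · rw [e', e _ le_rfl hm]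
    lia

/-- Lengthening the stem by one value that obeys the commitment. -/
theorem append_le (p : HechlerCond) {a : ℕ} (ha : p.commitment p.stem.length ≤ a) :
    ⟨p.stem ++ [a], p.commitment⟩ ≤ p := by
  refine le_iff.2 ⟨List.prefix_append _ _, fun _ => le_rfl, fun i hi hi' => ?_⟩
  obtain rfl : i = p.stem.length := by simp at hi'; lia
  simpa using ha

/-- Every sequence has its value decided by a dense set of stems. -/
theorem exists_le_exists_runEnd (u : List ℕ) (p : HechlerCond) :
    ∃ q ≤ p, ∃ m, RunEnd u q.stem m := by
  -- First the stem is made long enough, with two different values at its end.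
  obtain ⟨p', hp', hlen, hne⟩ : ∃ q ≤ p, u.length + 1 < q.stem.length ∧
      ∃ i, u.length ≤ i ∧ i + 1 < q.stem.length ∧ q.stem.getD i 0 ≠ q.stem.getD (i + 1) 0 := by
    obtain ⟨q, hq, h | h⟩ := p.exists_le_runEnd (m := p.stem.length + u.length + 1) (by lia)
    · exact absurd hq.1 h.2.1
    · obtain ⟨-, -, h3, h4, h5⟩ := h
      refine ⟨q, hq, by lia, p.stem.length + u.length, by lia, h3, ?_⟩
      rw [h4 _ (by lia) (by lia)]
      exact h5.symm
  refine ⟨p', hp', ?_⟩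
  by_cases hu : u <+: p'.stem
  · have hex : ∃ m, u.length ≤ m ∧ m < p'.stem.length ∧
        p'.stem.getD m 0 ≠ p'.stem.getD u.length 0 := by
      obtain ⟨i, hi, hi', hne⟩ := hne
      by_cases h : p'.stem.getD i 0 = p'.stem.getD u.length 0
      · exact ⟨i + 1, by lia, hi', fun h' => hne (h.trans h'.symm)⟩
      · exact ⟨i, hi, by lia, h⟩
    classical
    obtain ⟨h1, h2, h3⟩ := Nat.find_spec hex
    refine ⟨Nat.find hex, .inr ⟨hu, lt_of_le_of_ne h1 fun e => h3 (by rw [← e]), h2,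
      fun i hi him => ?_, h3⟩⟩
    by_contra h
    exact Nat.find_min hex him ⟨hi, him.trans h2, h⟩
  · exact ⟨0, .inl ⟨by lia, hu, rfl⟩⟩

open Forcing

/-- The `n`-th finite sequence of natural numbers. -/
abbrev nthSeq (n : ℕ) : List ℕ := Denumerable.ofNat (List ℕ) n

/-- The name of the real that maps `n` to the end of the run on which the generic real is constant
right after its initial segment `nthSeq n`, and to `0` if `nthSeq n` is not an initial segment of
the generic real. -/
def runReal : PName.{u} HechlerCond := relName fun p n m => RunEnd (nthSeq n) p.stem m

theorem exists_runEnd_of_val {n m : ℕ} {p : HechlerCond} (h : Val runReal.{u} n m p) :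
    ∃ q ≤ p, RunEnd (nthSeq n) q.stem m :=
  exists_of_val_relName (fun _ _ _ _ hq h => h.mono hq.1) h

theorem isUnbounded_runReal (p : HechlerCond) : isUnbounded runReal.{u} p := by
  refine ⟨isReal_relName (fun _ _ _ _ hq h => h.mono hq.1) (fun _ _ _ _ h h' => h.unique h')
    (fun p n => exists_le_exists_runEnd _ p) p, fun h q _ hle => ?_⟩
  obtain ⟨r, -, k, hk⟩ := eventuallyLE_iff.1 hle q le_rfl
  -- Infinitely many one-point extensions of the stem obey the commitment, so some have code `≥ k`.
  obtain ⟨a, ha, hak⟩ : ∃ a, r.commitment r.stem.length ≤ a ∧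
      k ≤ Encodable.encode (r.stem ++ [a]) := by
    have hinj : Function.Injective fun a : ℕ => Encodable.encode (r.stem ++ [a]) :=
      fun a b hab => by simpa using Encodable.encode_injective hab
    have := (hinj.tendsto_cofinite.eventually
      (Set.finite_Iio k).eventually_cofinite_notMem)
    rw [Nat.cofinite_eq_atTop] at this
    obtain ⟨a, h1, h2⟩ := (this.and (Filter.eventually_ge_atTop (r.commitment r.stem.length))).exists
    exact ⟨a, h2, not_lt.1 h1⟩
  set n := Encodable.encode (r.stem ++ [a]) with hn
  have hnth : nthSeq n = r.stem ++ [a] := Denumerable.ofNat_encode _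
  obtain ⟨s, hs, hrun⟩ := exists_le_runEnd ⟨r.stem ++ [a], r.commitment⟩
    (m := (r.stem ++ [a]).length + h n + 1) (by simp only; lia)
  have := hk n hak s (hs.trans (r.append_le ha)) _ (h n)
    (val_relName (show RunEnd (nthSeq n) s.stem _ from hnth ▸ hrun)) (val_groundReal h n s)
  lia

/-! ### Comparison with dominating reals -/

/-- The stem `s` allows that the value of `y` at `n` is at most `m`: no commitment rules this
out. -/
def Allows (y : PName.{u} HechlerCond) (s : List ℕ) (n m : ℕ) : Prop :=
  ∀ f, ∃ r : HechlerCond, r ≤ ⟨s, f⟩ ∧ ∃ m' ≤ m, Val y n m' r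

/-- Every dominating real eventually dominates `runReal`. -/
theorem eventuallyLE_runReal {y : PName.{u} HechlerCond} {p : HechlerCond}
    (hy : isDominating y p) : ∃ r ≤ p, eventuallyLE runReal y r := by
  classical
  obtain ⟨g, hgn, hg⟩ : ∃ g : ℕ → ℕ, (∀ n, n ≤ g n) ∧
      ∀ n m, Allows y (nthSeq n) n m → ∃ m' < g n, Allows y (nthSeq n) n m' := by
    have (n : ℕ) : ∃ b, n ≤ b ∧ ∀ m, Allows y (nthSeq n) n m →
        ∃ m' < b, Allows y (nthSeq n) n m' := by
      by_cases h : ∃ m, Allows y (nthSeq n) n m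
      · obtain ⟨m, hm⟩ := h
        exact ⟨max n (m + 1), le_max_left _ _, fun _ _ =>
          ⟨m, lt_max_of_lt_right m.lt_succ_self, hm⟩⟩
      · exact ⟨n, le_rfl, fun m hm => absurd ⟨m, hm⟩ h⟩
    choose g hg using this
    exact ⟨g, fun n => (hg n).1, fun n => (hg n).2⟩
  -- `Allows` does not depend on `p`, so one `g` serves all stems below `q` at once.
  obtain ⟨q, hq, k, hk⟩ := eventuallyLE_iff.1 (hy.2 g) p le_rfl
  have hadm (n : ℕ) (hn : k ≤ n) (hle : ⟨nthSeq n, q.commitment⟩ ≤ q) (m : ℕ) :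
      ¬ Allows y (nthSeq n) n m := by
    intro h
    obtain ⟨m₁, hm₁, h⟩ := hg n m h
    obtain ⟨r, hr, m₂, hm₂, h⟩ := h q.commitment
    have := hk n hn r (hr.trans hle) _ m₂ (val_groundReal g n r) h
    lia
  have (n m : ℕ) : ∃ f : ℕ → ℕ, ¬ Allows y (nthSeq n) n m →
      ∀ r : HechlerCond, r ≤ ⟨nthSeq n, f⟩ → ∀ m' ≤ m, ¬ Val y n m' r := by
    by_cases h : Allows y (nthSeq n) n m
    · exact ⟨0, fun h' => absurd h h'⟩
    · obtain ⟨f, hf⟩ := not_forall.1 h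
      exact ⟨f, fun _ r hr m' hm hv => hf ⟨r, hr, m', hm, hv⟩⟩
  choose F hF using this
  obtain ⟨f, hqf, hFf⟩ : ∃ f : ℕ → ℕ, (∀ j, q.commitment j ≤ f j) ∧
      ∀ j n m i, n ≤ j → m ≤ j + 1 → i ≤ j → F n m i ≤ f j := by
    have (j : ℕ) : ∃ b, q.commitment j ≤ b ∧
        ∀ n m i, n ≤ j → m ≤ j + 1 → i ≤ j → F n m i ≤ b := by
      obtain ⟨b, hb⟩ := ((((Set.finite_Iic j).prod (Set.finite_Iic (j + 1))).prod
        (Set.finite_Iic j)).image fun x : (ℕ × ℕ) × ℕ => F x.1.1 x.1.2 x.2).bddAbove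
      exact ⟨max (q.commitment j) b, le_max_left _ _, fun n m i hn hm hi =>
        le_max_of_le_right (hb ⟨((n, m), i), ⟨⟨hn, hm⟩, hi⟩, rfl⟩)⟩
    choose f hf using this
    exact ⟨f, fun j => (hf j).1, fun j => (hf j).2⟩
  -- Only finitely many `n` code an initial segment of the stem.
  obtain ⟨l, hl⟩ : ∃ l, ∀ n ≥ l, ¬ nthSeq n <+: q.stem := by
    obtain ⟨b, hb⟩ := (q.stem.inits.toFinset.finite_toSet.image Encodable.encode).bddAbove
    refine ⟨b + 1, fun n hn hpre => ?_⟩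
    have := hb ⟨nthSeq n, by simpa using hpre, rfl⟩
    rw [Denumerable.encode_ofNat] at this
    lia
  have hqle : (⟨q.stem, f⟩ : HechlerCond) ≤ q :=
    le_iff.2 ⟨List.prefix_refl _, hqf, fun i hi hi' => absurd hi' (by simpa using hi)⟩
  refine ⟨⟨q.stem, f⟩, hqle.trans hq, eventuallyLE_iff.2 fun q' hq' =>
    ⟨q', le_rfl, max k l, fun n hn s hs a b ha hb => ?_⟩⟩
  obtain ⟨r, hr, hrun⟩ := exists_runEnd_of_val ha
  replace hb := hb.mono hr
  have hr' : r ≤ ⟨q.stem, f⟩ := hr.trans (hs.trans hq')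
  obtain ⟨hstem, hcom, hval⟩ := le_iff.1 hr'
  by_contra! hab
  obtain ⟨-, -, rfl⟩ | ⟨hu, hua, har, hconst, -⟩ := hrun
  · exact absurd hab (Nat.not_lt_zero _)
  have hbg := hk n (le_of_max_le_left hn) r (hr'.trans hqle) _ b (val_groundReal g n r) hb
  -- Since `n ≤ g n`, the run ends beyond `n`, where `f` bounds the commitments `F n a`.
  have hna : n < a := ((hgn n).trans hbg).trans_lt hab
  have hsu : q.stem <+: nthSeq n := (List.prefix_or_prefix_of_prefix hstem hu).resolve_right
    (hl n (le_of_max_le_right hn))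
  have hule : (⟨nthSeq n, q.commitment⟩ : HechlerCond) ≤ q :=
    le_iff.2 ⟨hsu, fun _ => le_rfl, fun i hi hi' => by
      rw [← getD_of_prefix hu hi']
      exact (hqf i).trans (hval i hi (hi'.trans_le hu.length_le))⟩
  -- The values after `nthSeq n` obey the commitment `F n a`: those of the run since they are equal
  -- to its last one, which is at least `f (a - 1)`, and the later ones since `f` is large there.
  have hcompat : (⟨r.stem, fun i => max (r.commitment i) (F n a i)⟩ : HechlerCond) ≤
      ⟨nthSeq n, F n a⟩ := by
    refine le_iff.2 ⟨hu, fun i => le_max_right _ _, fun i hi hir => ?_⟩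
    have hsi := hsu.length_le
    simp only at hi hir hval ⊢
    obtain hia | hai := lt_or_ge i a
    · rw [hconst i hi hia, ← hconst (a - 1) (by lia) (by lia)]
      exact (hFf (a - 1) n a i (by lia) (by lia) (by lia)).trans
        (hval (a - 1) (by lia) (by lia))
    · exact (hFf i n a i (by lia) (by lia) le_rfl).trans (hval i (by lia) hir)
  refine hF n a (hadm n (le_of_max_le_left hn) hule a) _ hcompat b hab.le (hb.mono ?_)
  exact le_iff.2 ⟨List.prefix_refl _, fun i => le_max_left _ _,
    fun i hi hi' => absurd hi' (by simpa using hi)⟩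

end HechlerCond

theorem theorem2 :
    ∀ p : HechlerCond, Forcing.Forces p
      (Forcing.ex fun x : Forcing.PName.{u} HechlerCond =>
        Forcing.conj (Forcing.isUnbounded x)
          (Forcing.all fun y : Forcing.PName.{u} HechlerCond =>
            Forcing.imp (Forcing.isDominating y) (Forcing.eventuallyLE x y))) := by
  intro p
  refine Forcing.ex_iff.2 fun q _ => ⟨q, le_rfl, HechlerCond.runReal,
    HechlerCond.isUnbounded_runReal q, fun y => Forcing.imp_iff.2 fun r _ hy => ?_⟩
  exact HechlerCond.eventuallyLE_runReal hy
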